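/- Let $\mathscr L$ be a (one-sorted) first order language, $\mathsf T$ a first order theory in $\mathscr L$ and $\mathcal K$ the class of its models. A formula is \emph{quasi-algebraic} if it has the form $\forall\overline y\,[\bigwedge\Phi(\overline x,\overline y)\Rightarrow\psi(\overline x,\overline y)]$ with $\Phi\cup\{\psi\}$ a finite set of atomic formulas. Let $\mathsf{T_W}$ be the set of quasi-algebraic consequences of $\mathsf T$ and $\mathcal W=\mathcal W_{\mathcal K}=Mod(\mathsf{T_W})$, the quasivariety generated by $\mathcal K$. Let $A$ be an $\mathscr L$-structure. An \emph{$A$-algebra} is a homomorphism $f:A\to B$ of $\mathscr L$-structures; it is \emph{reduced} if $B\in\mathcal W$. Reduced $A$-algebras form a category $\mathcal W_A$, whose morphisms are the homomorphisms commuting with the maps from $A$. A reduced $A$-algebra $B$ is \emph{finitely presented} if there are a finite set $\pi(x_1,\dots,x_n)$ of atomic formulas with parameters in $A$ and a tuple $\overline b\in B^n$ satisfying $\pi$ (parameters being interpreted through $f$) such that for every reduced $A$-algebra $C$ and every $\overline c\in C^n$ satisfying $\pi$ there is exactly one morphism of $A$-algebras $B\to C$ with $\overline b\mapsto\overline c$.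 Let $\mathcal W_A^{fin}$ be the full subcategory of finitely presented reduced $A$-algebras. $A$ is \emph{geometrically closed in $\mathcal W$} if $A\in\mathcal W$ and, for every homomorphism $f:A\to B$ with $B\in\mathcal W$, every quasi-algebraic sentence with parameters in $A$ which is true in $A$ is true in $B$ (parameters being interpreted through $f$). An \emph{affine algebraic variety} over $A$ is a subset $V\subseteq A^n$ ($n\in\mathbb N$) of the form $V=\pi(A)=\{\overline a\in A^n: A\models\bigwedge\pi(\overline a)\}$ for a finite set $\pi(x_1,\dots,x_n)$ of atomic formulas with parameters in $A$. Let $Th_W(A|A)$ be the set of quasi-algebraic sentences with parameters in $A$ which are true in $A$. A \emph{morphism} from $V=\pi_1(A)\subseteq A^n$ to $W=\pi_2(A)\subseteq A^m$ is a map $f:V\to W$ for which there is a finite conjunction $\phi(\overline x,\overline y)$ of atomic formulas with parameters in $A$ such that, modulo $Th_W(A|A)$: (i) $\phi(\overline x,\overline y)\wedge\phi(\overline x,\overline y')$ implies $\overline y=\overline y'$; (ii) $\bigwedge\pi_1(\overline x)$ is equivalent to $\exists\overline y\,\phi(\overline x,\overline y)$; (iii) $\phi(\overline x,\overline y)$ implies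 $\bigwedge\pi_2(\overline y)$; and such that (iv) for all $(\overline b,\overline c)\in V\times W$, $f(\overline b)=\overline c$ if and only if $A\models\phi(\overline b,\overline c)$. (These are exactly the maps $f:V\to W$ given by an $m$-tuple $\overline t(\overline x)$ of terms with parameters in $A$, i.e. $f(\overline a)=\overline t^A(\overline a)$ for all $\overline a\in V$.) Affine varieties over $A$ and their morphisms form a category $Aff_A$. The \emph{affine coordinate algebra} $A[V]$ of $V\subseteq A^n$ is the $A$-algebra obtained as the quotient of the algebra of terms with parameters in $A$ in the variables $x_1,\dots,x_n$ by the set of all atomic formulas (with parameters in $A$) which hold at every point of $V$: two terms are identified iff they take the same values on $V$, and a relation holds of classes of terms iff it holds of their values at every point of $V$. If $A\in\mathcal W$, then $V\mapsto A[V]$ is a contravariant functor $\mathbf A:Aff_A\to\mathcal W_A$, where for $f:V\to W$ given by terms $\overline t(\overline x)$, $A[f]:A[W]\to A[V]$ is the morphism of $A$-algebras sending the class of $y_j$ to the class of $t_j(\overline x)$. \textbf{Theorem.} If $A$ is a geometrically closed object of $\mathcal W=\mathcal W_{\mathcal K}$, then the functor $\mathbf A$ takes its values in $\mathcal W_A^{fin}$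 and is a duality (a contravariant equivalence of categories) between $Aff_A$ and $\mathcal W_A^{fin}$. -/

import Mathlib

open FirstOrder CategoryTheory

universe u v w w₁ w₂

namespace FormalGeometry

open FirstOrder.Language

section QuasiAlgebraic

variable {L : FirstOrder.Language.{u, v}}

/-- `φ` is a quasi-algebraic formula: it is of the form `∀ y, ⋀ Φ(x, y) ⇒ ψ(x, y)`, where `Φ ∪ {ψ}`
is a finite set of atomic formulas. The free variables `x` are indexed by `α`. -/
def IsQuasiAlgebraic {α : Type w} (φ : L.Formula α) : Prop :=
  ∃ (n : ℕ) (Φ : List (L.BoundedFormula α n)) (ψ : L.BoundedFormula α n),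
    (∀ θ ∈ Φ, θ.IsAtomic) ∧ ψ.IsAtomic ∧ φ = ((Φ.foldr (· ⊓ ·) ⊤).imp ψ).alls

/-- The set `T_W` of quasi-algebraic consequences of the theory `T`. Its models form the quasivariety
generated by the class of models of `T`. (Structures are allowed to be empty.) -/
def quasiAlgPart (T : L.Theory) : L.Theory :=
  {σ | IsQuasiAlgebraic σ ∧ ∀ (M : Type (max u v)) [L.Structure M], M ⊨ T → M ⊨ σ}

/-- The quasi-algebraic diagram `Th_W(A|A)`: all quasi-algebraic sentences with parameters in `A`
which are true in `A`. A sentence of `L(A)` is given as a formula of `L` whose free variables are the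
elements of `A`; an `L(A)`-structure is then an `L`-structure `B` with a map `A → B`. -/
def quasiAlgDiagram (L : FirstOrder.Language.{u, v}) (A : Type w) [L.Structure A] : Set (L.Formula A) :=
  {σ | IsQuasiAlgebraic σ ∧ σ.Realize id}

/-- The `L(A)`-structure `(B, f)` is a model of `Th_W(A|A)`. -/
def IsDiagramModel (L : FirstOrder.Language.{u, v}) {A : Type w₁} [L.Structure A] {B : Type w₂} [L.Structure B]
    (f : A → B) : Prop :=
  ∀ σ ∈ quasiAlgDiagram L A, σ.Realize f

/-- A homomorphism `f : A → B` is geometrically closed if every quasi-algebraic sentence with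
parameters in `A` which is true in `A` is true in `B` (parameters being interpreted through `f`). -/
def HomGeomClosed {A : Type w₁} [L.Structure A] {B : Type w₂} [L.Structure B] (f : A →[L] B) : Prop :=
  ∀ σ : L.Formula A, IsQuasiAlgebraic σ → σ.Realize id → σ.Realize f

/-- `A` is a geometrically closed object of the class `Mod(T_W)`: every `A`-algebra in this class is
geometrically closed. (The universe is large enough: a failure in some `B` already occurs in a
substructure generated by the image of `A` and finitely many elements.) -/
def GeometricallyClosed (T : L.Theory) (A : Type w) [L.Structure A] : Prop :=
  A ⊨ quasiAlgPart T ∧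
    ∀ (B : Type (max u w)) [L.Structure B], B ⊨ quasiAlgPart T →
      ∀ f : A →[L] B, HomGeomClosed f

theorem realize_alls_imp {α : Type w} {B : Type w₂} [L.Structure B] {n : ℕ}
    (Φ : List (L.BoundedFormula α n)) (ψ : L.BoundedFormula α n) (f : α → B) :
    (((Φ.foldr (· ⊓ ·) ⊤).imp ψ).alls : L.Formula α).Realize f ↔
      ∀ b : Fin n → B, (∀ θ ∈ Φ, θ.Realize f b) → ψ.Realize f b := by
  simp [BoundedFormula.realize_alls, BoundedFormula.realize_foldr_inf]

end QuasiAlgebraic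

/-! ### Finite atomic types and substitution of terms -/

section Atomic

variable {L : FirstOrder.Language.{u, v}}

/-- A finite `a`-type of `A[x₁, …, xₙ]`: a finite set of atomic formulas with parameters in `A`
and variables `x₁, …, xₙ`. -/
def IsFiniteAType {A : Type w} {n : ℕ} (π : Set (L.BoundedFormula A n)) : Prop :=
  π.Finite ∧ ∀ φ ∈ π, φ.IsAtomic

/-- `B ⊨ ⋀ π(b)`, the parameters of `π` being interpreted through `f : A → B`. -/
def Satisfies {A : Type w₁} {B : Type w₂} [L.Structure B] {n : ℕ} (π : Set (L.BoundedFormula A n))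
    (f : A → B) (b : Fin n → B) : Prop :=
  ∀ φ ∈ π, φ.Realize f b

/-- The set `π(A)` of rational points of `π` in `A`. -/
def zeros {A : Type w} [L.Structure A] {n : ℕ} (π : Set (L.BoundedFormula A n)) :
    Set (Fin n → A) :=
  {a | Satisfies π id a}

/-- The value of the term `t(x₁, …, xₙ)`, with parameters in `A`, at the tuple `b` of `B`, where
the parameters are interpreted through `f : A → B`. -/
abbrev tval {A : Type w₁} {B : Type w₂} [L.Structure B] {n : ℕ} (f : A → B) (b : Fin n → B)
    (t : L.Term (A ⊕ Fin n)) : B :=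
  t.realize (Sum.elim f b)

/-- The term `s(t₁(x), …, tₙ(x))`. -/
def substTerm {A : Type w} {n k : ℕ} (t : Fin n → L.Term (A ⊕ Fin k)) (s : L.Term (A ⊕ Fin n)) :
    L.Term (A ⊕ Fin k) :=
  s.subst (Sum.elim (fun a => Term.var (Sum.inl a)) t)

theorem tval_substTerm {A : Type w₁} {B : Type w₂} [L.Structure B] {n k : ℕ} (f : A → B)
    (b : Fin k → B) (t : Fin n → L.Term (A ⊕ Fin k)) (s : L.Term (A ⊕ Fin n)) :
    tval f b (substTerm t s) = tval f (fun i => tval f b (t i)) s := by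
  unfold substTerm tval
  rw [Term.realize_subst]
  congr 1
  funext i
  cases i <;> rfl

/-- Substitution of terms for the variables of an atomic formula (other formulas are irrelevant). -/
def substAtomic {A : Type w} {k : ℕ} :
    ∀ {n : ℕ}, (Fin n → L.Term (A ⊕ Fin k)) → L.BoundedFormula A n → L.BoundedFormula A k
  | _, t, .equal s₁ s₂ => .equal (substTerm t s₁) (substTerm t s₂)
  | _, t, .rel R ts => .rel R fun i => substTerm t (ts i)
  | _, _, _ => .falsum

theorem isAtomic_substAtomic {A : Type w} {n k : ℕ} (t : Fin n → L.Term (A ⊕ Fin k))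
    {φ : L.BoundedFormula A n} (hφ : φ.IsAtomic) : (substAtomic t φ).IsAtomic := by
  cases hφ with
  | equal s₁ s₂ => exact .equal _ _
  | rel R ts => exact .rel _ _

theorem realize_substAtomic {A : Type w₁} {B : Type w₂} [L.Structure B] {n k : ℕ} (f : A → B)
    (b : Fin k → B) (t : Fin n → L.Term (A ⊕ Fin k)) {φ : L.BoundedFormula A n} (hφ : φ.IsAtomic) :
    (substAtomic t φ).Realize f b ↔ φ.Realize f (fun i => tval f b (t i)) := by
  cases hφ with
  | equal s₁ s₂ =>
    change tval f b (substTerm t s₁) = tval f b (substTerm t s₂) ↔ _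
    rw [tval_substTerm, tval_substTerm]
    rfl
  | rel R ts =>
    change Structure.RelMap R (fun i => tval f b (substTerm t (ts i))) ↔ _
    simp only [tval_substTerm]
    rfl

/-- A finite atomic implication true in `A` is true in all models of the quasi-algebraic diagram. -/
theorem IsDiagramModel.transfer {A : Type w₁} [L.Structure A] {B : Type w₂} [L.Structure B]
    {f : A → B} (hf : IsDiagramModel L f) {n : ℕ} {π : Set (L.BoundedFormula A n)}
    (hπ : IsFiniteAType π) {ψ : L.BoundedFormula A n} (hψ : ψ.IsAtomic)
    (h : ∀ a : Fin n → A, Satisfies π id a → ψ.Realize id a) (b : Fin n → B)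
    (hb : Satisfies π f b) : ψ.Realize f b := by
  have hmem : (((hπ.1.toFinset.toList.foldr (· ⊓ ·) ⊤).imp ψ).alls : L.Formula A) ∈
      quasiAlgDiagram L A := by
    refine ⟨⟨n, hπ.1.toFinset.toList, ψ, ?_, hψ, rfl⟩, ?_⟩
    · intro θ hθ
      exact hπ.2 θ (by simpa using hθ)
    · rw [realize_alls_imp]
      intro a ha
      exact h a fun θ hθ => ha θ (by simpa using hθ)
  have := hf _ hmem
  rw [realize_alls_imp] at this
  exact this b fun θ hθ => hb θ (by simpa using hθ)

end Atomic

/-! ### Affine varieties and their coordinate algebras -/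

/-- An affine algebraic variety over `A`: a subset of some `Aⁿ` of the form `π(A)` for a finite
`a`-type `π` of `A[x₁, …, xₙ]`. -/
structure AffVar (L : FirstOrder.Language.{u, v}) (A : Type w) [L.Structure A] where
  dim : ℕ
  carrier : Set (Fin dim → A)
  isAffine : ∃ π : Set (L.BoundedFormula A dim), IsFiniteAType π ∧ carrier = zeros π

/-- `f : V → W` is a morphism of affine varieties: writing `V = π₁(A)` and `W = π₂(A)`, there is a
finite conjunction `Φ(x, y)` of atomic formulas with parameters in `A` such that, modulo `Th_W(A|A)`,
`Φ` is functional in `x`, `⋀ π₁(x)` is equivalent to `∃ y, Φ(x, y)` and `Φ(x, y)` implies `π₂(y)`;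
and `Φ` defines `f` in `A`. -/
def IsMorphism {L : FirstOrder.Language.{u, v}} {A : Type w} [L.Structure A] (V W : AffVar L A)
    (f : V.carrier → W.carrier) : Prop :=
  ∃ (π₁ : Set (L.BoundedFormula A V.dim)) (π₂ : Set (L.BoundedFormula A W.dim))
    (Φ : Set (L.BoundedFormula A (V.dim + W.dim))),
    (IsFiniteAType π₁ ∧ V.carrier = zeros π₁) ∧ (IsFiniteAType π₂ ∧ W.carrier = zeros π₂) ∧
    IsFiniteAType Φ ∧
    (∀ (B : Type (max u v w)) [L.Structure B] (e : A → B), IsDiagramModel L e →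
      (∀ b c c', Satisfies Φ e (Fin.append b c) → Satisfies Φ e (Fin.append b c') → c = c') ∧
      (∀ b, Satisfies π₁ e b ↔ ∃ c, Satisfies Φ e (Fin.append b c)) ∧
      (∀ b c, Satisfies Φ e (Fin.append b c) → Satisfies π₂ e c)) ∧
    ∀ (a : V.carrier) (c : W.carrier), f a = c ↔ Satisfies Φ id (Fin.append a.1 c.1)

/-- `tp_a^A(V)`: the set of atomic formulas with parameters in `A` which hold at all points of
`V ⊆ Aⁿ`. -/
def atypeOf {L : FirstOrder.Language.{u, v}} {A : Type w} [L.Structure A] {n : ℕ} (V : Set (Fin n → A)) :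
    Set (L.BoundedFormula A n) :=
  {φ | φ.IsAtomic ∧ ∀ a ∈ V, φ.Realize id a}

section Coordinate

variable {L : FirstOrder.Language.{u, v}} {A : Type w} [L.Structure A]

theorem bdEqual_mem_atypeOf {n : ℕ} {V : Set (Fin n → A)} {s t : L.Term (A ⊕ Fin n)} :
    s.bdEqual t ∈ atypeOf V ↔ ∀ a ∈ V, tval id a s = tval id a t :=
  ⟨fun h => h.2, fun h => ⟨.equal _ _, h⟩⟩

theorem rel_mem_atypeOf {n l : ℕ} {V : Set (Fin n → A)} {R : L.Relations l}
    {ts : Fin l → L.Term (A ⊕ Fin n)} :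
    R.boundedFormula ts ∈ atypeOf V ↔ ∀ a ∈ V, Structure.RelMap R fun i => tval id a (ts i) :=
  ⟨fun h => h.2, fun h => ⟨.rel _ _, h⟩⟩

/-- Two terms are identified when the formula `s = t` is in `tp_a^A(V)`. -/
def coordSetoid (V : AffVar L A) : Setoid (L.Term (A ⊕ Fin V.dim)) where
  r s t := s.bdEqual t ∈ atypeOf V.carrier
  iseqv :=
    { refl := fun _ => bdEqual_mem_atypeOf.2 fun _ _ => rfl
      symm := fun h => bdEqual_mem_atypeOf.2 fun a ha => (bdEqual_mem_atypeOf.1 h a ha).symm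
      trans := fun h h' => bdEqual_mem_atypeOf.2 fun a ha =>
        (bdEqual_mem_atypeOf.1 h a ha).trans (bdEqual_mem_atypeOf.1 h' a ha) }

theorem coordSetoid_iff {V : AffVar L A} {s t : L.Term (A ⊕ Fin V.dim)} :
    (coordSetoid V) s t ↔ ∀ a ∈ V.carrier, tval id a s = tval id a t :=
  bdEqual_mem_atypeOf

/-- Function symbols act on terms formally; `R(t₁, …, tₗ)` holds when it belongs to `tp_a^A(V)`. -/
instance coordPrestructure (V : AffVar L A) : L.Prestructure (coordSetoid V) where
  toStructure :=
    { funMap := fun f ts => Term.func f ts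
      RelMap := fun R ts => R.boundedFormula ts ∈ atypeOf V.carrier }
  fun_equiv := fun {l f} x y h => by
    refine coordSetoid_iff.2 fun a ha => ?_
    change Structure.funMap f (fun i => tval id a (x i)) =
      Structure.funMap f (fun i => tval id a (y i))
    congr 1
    funext i
    exact coordSetoid_iff.1 (h i) a ha
  rel_equiv := fun {l R} x y h => by
    refine propext ?_
    change R.boundedFormula x ∈ atypeOf V.carrier ↔ R.boundedFormula y ∈ atypeOf V.carrier
    rw [rel_mem_atypeOf, rel_mem_atypeOf]
    refine forall₂_congr fun a ha => ?_
    have : (fun i => tval id a (x i)) = fun i => tval id a (y i) :=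
      funext fun i => coordSetoid_iff.1 (h i) a ha
    rw [this]

/-- The affine coordinate algebra `A[V]`: the quotient of the algebra of terms `A[x₁, …, xₙ]`
by the `a`-type `tp_a^A(V)`. -/
def CoordAlg (V : AffVar L A) : Type (max u w) := Quotient (coordSetoid V)

/-- The class of a term in `A[V]`. -/
def CoordAlg.mk (V : AffVar L A) (t : L.Term (A ⊕ Fin V.dim)) : CoordAlg V :=
  Quotient.mk (coordSetoid V) t

instance (V : AffVar L A) : L.Structure (CoordAlg V) :=
  inferInstanceAs (L.Structure (Quotient (coordSetoid V)))

namespace CoordAlg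

theorem mk_eq {V : AffVar L A} {s t : L.Term (A ⊕ Fin V.dim)} :
    mk V s = mk V t ↔ ∀ a ∈ V.carrier, tval id a s = tval id a t :=
  Quotient.eq.trans coordSetoid_iff

theorem mk_surj {V : AffVar L A} (x : CoordAlg V) : ∃ t, mk V t = x := Quotient.exists_rep x

theorem funMap_mk {V : AffVar L A} {l : ℕ} (f : L.Functions l)
    (ts : Fin l → L.Term (A ⊕ Fin V.dim)) :
    Structure.funMap f (fun i => mk V (ts i)) = mk V (Term.func f ts) :=
  funMap_quotient_mk' (coordSetoid V) f ts

theorem relMap_mk {V : AffVar L A} {l : ℕ} (R : L.Relations l)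
    (ts : Fin l → L.Term (A ⊕ Fin V.dim)) :
    Structure.RelMap R (fun i => mk V (ts i)) ↔
      ∀ a ∈ V.carrier, Structure.RelMap R fun i => tval id a (ts i) :=
  (relMap_quotient_mk' (coordSetoid V) R ts).trans rel_mem_atypeOf

/-- The structural homomorphism `A → A[V]`, sending `a` to the class of the constant term `a`. -/
def ofBase (V : AffVar L A) : A →[L] CoordAlg V where
  toFun a := mk V (Term.var (Sum.inl a))
  map_fun' f x := by
    have h : ((fun a => mk V (Term.var (Sum.inl a))) ∘ x) =
      fun i => mk V (Term.var (Sum.inl (x i))) := rfl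
    rw [h, funMap_mk, mk_eq]
    intro a _
    rfl
  map_rel' R x hx := by
    have h : ((fun a => mk V (Term.var (Sum.inl a))) ∘ x) =
      fun i => mk V (Term.var (Sum.inl (x i))) := rfl
    rw [h, relMap_mk]
    intro a _
    exact hx

/-- The class of the variable `xᵢ` in `A[V]`. -/
def coord (V : AffVar L A) (i : Fin V.dim) : CoordAlg V := mk V (Term.var (Sum.inr i))

theorem realize_mk {V : AffVar L A} {β : Type w₁} (t : L.Term β)
    (s : β → L.Term (A ⊕ Fin V.dim)) :
    t.realize (fun i => mk V (s i)) = mk V (t.subst s) := by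
  induction t with
  | var => rfl
  | func f ts ih =>
    simp only [Term.realize, Term.subst]
    rw [← funMap_mk]
    congr 1
    funext i
    exact ih i

theorem tval_mk {V : AffVar L A} {k : ℕ} (t : L.Term (A ⊕ Fin k))
    (s : Fin k → L.Term (A ⊕ Fin V.dim)) :
    tval (ofBase V) (fun i => mk V (s i)) t = mk V (substTerm s t) := by
  rw [substTerm, ← realize_mk]
  unfold tval
  congr 1
  funext i
  cases i <;> rfl

/-- Atomic formulas are satisfied in `A[V]` iff they are satisfied at all points of `V`. -/
theorem realize_atomic {V : AffVar L A} {k : ℕ} {φ : L.BoundedFormula A k} (hφ : φ.IsAtomic)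
    (s : Fin k → L.Term (A ⊕ Fin V.dim)) :
    φ.Realize (ofBase V) (fun i => mk V (s i)) ↔
      ∀ a ∈ V.carrier, φ.Realize id (fun i => tval id a (s i)) := by
  cases hφ with
  | equal t₁ t₂ =>
    change tval (ofBase V) (fun i => mk V (s i)) t₁ = tval (ofBase V) (fun i => mk V (s i)) t₂ ↔ _
    rw [tval_mk, tval_mk, mk_eq]
    simp only [tval_substTerm]
    rfl
  | rel R ts =>
    change Structure.RelMap R (fun i => tval (ofBase V) (fun i => mk V (s i)) (ts i)) ↔ _
    simp only [tval_mk]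
    rw [relMap_mk]
    simp only [tval_substTerm]
    rfl

theorem realize_atomic_empty {V : AffVar L A} {k : ℕ} {φ : L.BoundedFormula Empty k}
    (hφ : φ.IsAtomic) (s : Fin k → L.Term (A ⊕ Fin V.dim)) :
    φ.Realize (default : Empty → CoordAlg V) (fun i => mk V (s i)) ↔
      ∀ a ∈ V.carrier, φ.Realize (default : Empty → A) (fun i => tval id a (s i)) := by
  have key : ∀ t : L.Term (Empty ⊕ Fin k),
      t.realize (Sum.elim (default : Empty → CoordAlg V) (fun i => mk V (s i))) =
        mk V (t.subst (Sum.elim (fun e => e.elim) s)) := by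
    intro t
    rw [← realize_mk]
    congr 1
    funext i
    rcases i with e | i
    · exact e.elim
    · rfl
  have key' : ∀ (t : L.Term (Empty ⊕ Fin k)) (a : Fin V.dim → A),
      tval id a (t.subst (Sum.elim (fun e => e.elim) s)) =
        t.realize (Sum.elim (default : Empty → A) (fun i => tval id a (s i))) := by
    intro t a
    unfold tval
    rw [Term.realize_subst]
    congr 1
    funext i
    rcases i with e | i
    · exact e.elim
    · rfl
  cases hφ with
  | equal t₁ t₂ =>
    simp only [BoundedFormula.realize_bdEqual, key, mk_eq, key']
  | rel R ts =>
    simp only [BoundedFormula.realize_rel, key, relMap_mk, key']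

theorem exists_rep {V : AffVar L A} {k : ℕ} (b : Fin k → CoordAlg V) :
    ∃ s : Fin k → L.Term (A ⊕ Fin V.dim), b = fun i => mk V (s i) := by
  choose s hs using fun i => mk_surj (b i)
  exact ⟨s, funext fun i => (hs i).symm⟩

/-- `A[V]` is a model of the quasi-algebraic diagram of `A`. -/
theorem isDiagramModel (V : AffVar L A) : IsDiagramModel L (ofBase V) := by
  rintro σ ⟨⟨n, Φ, ψ, hΦ, hψ, rfl⟩, hA⟩
  rw [realize_alls_imp] at hA ⊢
  intro b hb
  obtain ⟨s, rfl⟩ := exists_rep b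
  rw [realize_atomic hψ]
  intro a ha
  exact hA _ fun θ hθ => (realize_atomic (hΦ θ hθ) s).1 (hb θ hθ) a ha

/-- `A[V]` lies in the quasivariety `Mod(T_W)` if `A` does. -/
theorem models {T : L.Theory} (hA : A ⊨ quasiAlgPart T) (V : AffVar L A) :
    CoordAlg V ⊨ quasiAlgPart T := by
  refine (Theory.model_iff _).2 fun σ hσ => ?_
  have h := (Theory.model_iff _).1 hA σ hσ
  obtain ⟨⟨n, Φ, ψ, hΦ, hψ, rfl⟩, -⟩ := hσ
  unfold Sentence.Realize at h ⊢
  rw [realize_alls_imp] at h ⊢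
  intro b hb
  obtain ⟨s, rfl⟩ := exists_rep b
  rw [realize_atomic_empty hψ]
  intro a ha
  exact h _ fun θ hθ => (realize_atomic_empty (hΦ θ hθ) s).1 (hb θ hθ) a ha

end CoordAlg

end Coordinate

/-! ### Morphisms of affine varieties are given by terms -/

section Morphisms

variable {L : FirstOrder.Language.{u, v}} {A : Type w} [L.Structure A]

/-- The tuple of terms `t` defines the map `f`. -/
def DefinedBy {V W : AffVar L A} (f : V.carrier → W.carrier)
    (t : Fin W.dim → L.Term (A ⊕ Fin V.dim)) : Prop :=
  ∀ (a : V.carrier) (j : Fin W.dim), (f a).1 j = tval id a.1 (t j)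

theorem isDiagramModel_of_equiv {B : Type w₁} [L.Structure B] {C : Type w₂} [L.Structure C]
    (g : B ≃[L] C) {e : A → B} (he : IsDiagramModel L e) : IsDiagramModel L (g ∘ e) := by
  intro σ hσ
  rw [StrongHomClass.realize_formula]
  exact he σ hσ

/-- The finite `a`-type `π(x) ∪ {y₁ = t₁(x), …, yₘ = tₘ(x)}`. -/
def graphType {A : Type w} {n m : ℕ} (π : Set (L.BoundedFormula A n))
    (t : Fin m → L.Term (A ⊕ Fin n)) : Set (L.BoundedFormula A (n + m)) :=
  substAtomic (fun i => Term.var (Sum.inr (Fin.castAdd m i))) '' π ∪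
    Set.range fun j =>
      (Term.var (Sum.inr (Fin.natAdd n j)) : L.Term (A ⊕ Fin (n + m))).bdEqual
        (substTerm (fun i => Term.var (Sum.inr (Fin.castAdd m i))) (t j))

theorem satisfies_graphType {A : Type w₁} {B : Type w₂} [L.Structure B] {n m : ℕ}
    {π : Set (L.BoundedFormula A n)} (hπ : IsFiniteAType π) (t : Fin m → L.Term (A ⊕ Fin n))
    (e : A → B) (b : Fin n → B) (c : Fin m → B) :
    Satisfies (graphType π t) e (Fin.append b c) ↔ Satisfies π e b ∧ ∀ j, c j = tval e b (t j) := by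
  have hx : (fun i => tval e (Fin.append b c)
      (Term.var (Sum.inr (Fin.castAdd m i)) : L.Term (A ⊕ Fin (n + m)))) = b := by
    funext i
    simp [tval]
  have hy : ∀ j, (substTerm (fun i => Term.var (Sum.inr (Fin.castAdd m i))) (t j) :
      L.Term (A ⊕ Fin (n + m))).realize (Sum.elim e (Fin.append b c)) = tval e b (t j) := by
    intro j
    refine (tval_substTerm e (Fin.append b c) _ (t j)).trans ?_
    rw [hx]
  constructor
  · intro h
    refine ⟨fun φ hφ => ?_, fun j => ?_⟩
    · have := h _ (Or.inl ⟨φ, hφ, rfl⟩)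
      rwa [realize_substAtomic _ _ _ (hπ.2 φ hφ), hx] at this
    · have := h _ (Or.inr ⟨j, rfl⟩)
      rw [BoundedFormula.realize_bdEqual, hy] at this
      simpa using this
  · rintro ⟨h1, h2⟩ φ (⟨φ, hφ, rfl⟩ | ⟨j, rfl⟩)
    · rw [realize_substAtomic _ _ _ (hπ.2 φ hφ), hx]
      exact h1 φ hφ
    · change BoundedFormula.Realize (Term.bdEqual _ _) _ _
      rw [BoundedFormula.realize_bdEqual, hy]
      simpa using h2 j

/-- A map between affine varieties is a morphism iff it is given by a tuple of terms. -/
theorem isMorphism_iff {V W : AffVar L A} (f : V.carrier → W.carrier) :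
    IsMorphism V W f ↔ ∃ t, DefinedBy f t := by
  constructor
  · rintro ⟨π₁, π₂, Φ, ⟨hπ₁, hV⟩, ⟨hπ₂, hW⟩, hΦ, hB, hf⟩
    let _ : L.Structure (ULift.{v} (CoordAlg V)) := Equiv.inducedStructure Equiv.ulift.symm
    let g : CoordAlg V ≃[L] ULift.{v} (CoordAlg V) := Equiv.inducedStructureEquiv Equiv.ulift.symm
    have hg := isDiagramModel_of_equiv g (CoordAlg.isDiagramModel V)
    obtain ⟨-, h2, -⟩ := hB _ _ hg
    have hx : Satisfies π₁ (g ∘ CoordAlg.ofBase V) (g ∘ CoordAlg.coord V) := by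
      intro φ hφ
      rw [StrongHomClass.realize_boundedFormula]
      refine (CoordAlg.realize_atomic (hπ₁.2 φ hφ) (fun i => Term.var (Sum.inr i))).2 ?_
      intro a ha
      rw [hV] at ha
      exact ha φ hφ
    obtain ⟨c, hc⟩ := (h2 _).1 hx
    obtain ⟨t, ht⟩ := CoordAlg.exists_rep (g.symm ∘ c)
    have hc' : c = g ∘ fun i => CoordAlg.mk V (t i) := by
      rw [← ht]
      funext i
      simp
    refine ⟨t, fun a j => ?_⟩
    have hsat : Satisfies Φ id (Fin.append a.1 fun j => tval id a.1 (t j)) := by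
      intro φ hφ
      have h := hc φ hφ
      have happ : Fin.append (g ∘ CoordAlg.coord V) c =
          g ∘ fun i => CoordAlg.mk V (Fin.append (fun i => Term.var (Sum.inr i)) t i) := by
        rw [hc']
        funext i
        refine Fin.addCases (fun i => ?_) (fun i => ?_) i
        · simp [CoordAlg.coord]
        · simp
      rw [happ, StrongHomClass.realize_boundedFormula, CoordAlg.realize_atomic (hΦ.2 φ hφ)] at h
      have h' := h a.1 a.2
      convert h' using 1
      funext i
      refine Fin.addCases (fun i => ?_) (fun i => ?_) i
      · simp [tval]
      · simp [tval]
    have hmem : (fun j => tval id a.1 (t j)) ∈ W.carrier := by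
      have h3 : Satisfies Φ id (Fin.append a.1 (f a).1) := (hf a (f a)).1 rfl
      let _ : L.Structure (ULift.{max u v} A) := Equiv.inducedStructure Equiv.ulift.symm
      let g' : A ≃[L] ULift.{max u v} A := Equiv.inducedStructureEquiv Equiv.ulift.symm
      have hid : IsDiagramModel L (id : A → A) := fun σ hσ => hσ.2
      obtain ⟨h1, -, -⟩ := hB _ _ (isDiagramModel_of_equiv g' hid)
      have lift : ∀ c : Fin W.dim → A, Satisfies Φ id (Fin.append a.1 c) →
          Satisfies Φ (g' ∘ id) (Fin.append (g' ∘ a.1) (g' ∘ c)) := by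
        intro c hc φ hφ
        have : Fin.append (g' ∘ a.1) (g' ∘ c) = g' ∘ Fin.append a.1 c := by
          funext i
          refine Fin.addCases (fun i => ?_) (fun i => ?_) i <;> simp
        rw [this, StrongHomClass.realize_boundedFormula]
        exact hc φ hφ
      have heq := h1 _ _ _ (lift _ hsat) (lift _ h3)
      have : (fun j => tval id a.1 (t j)) = (f a).1 := by
        funext j
        exact g'.injective (congrFun heq j)
      rw [this]
      exact (f a).2
    have := (hf a ⟨_, hmem⟩).2 hsat
    rw [this]
  · rintro ⟨t, ht⟩
    obtain ⟨π₁, hπ₁, hV⟩ := V.isAffine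
    obtain ⟨π₂, hπ₂, hW⟩ := W.isAffine
    let Φ := graphType π₁ t
    refine ⟨π₁, π₂, Φ, ⟨hπ₁, hV⟩, ⟨hπ₂, hW⟩, ⟨?_, ?_⟩, ?_, ?_⟩
    · exact (hπ₁.1.image _).union (Set.finite_range _)
    · rintro φ (⟨φ, hφ, rfl⟩ | ⟨j, rfl⟩)
      · exact isAtomic_substAtomic _ (hπ₁.2 φ hφ)
      · exact .equal _ _
    · intro B _ e he
      refine ⟨fun b c c' h h' => ?_, fun b => ⟨fun h => ?_, ?_⟩, fun b c h => ?_⟩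
      · funext j
        rw [((satisfies_graphType hπ₁ t e b c).1 h).2 j, ((satisfies_graphType hπ₁ t e b c').1 h').2 j]
      · exact ⟨_, (satisfies_graphType hπ₁ t e b _).2 ⟨h, fun j => rfl⟩⟩
      · rintro ⟨c, hc⟩
        exact ((satisfies_graphType hπ₁ t e b c).1 hc).1
      · obtain ⟨h1, h2⟩ := (satisfies_graphType hπ₁ t e b c).1 h
        intro φ hφ
        have := he.transfer hπ₁ (isAtomic_substAtomic t (hπ₂.2 φ hφ)) (fun a ha => by
          rw [realize_substAtomic _ _ _ (hπ₂.2 φ hφ)]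
          have ha' : a ∈ V.carrier := by rw [hV]; exact ha
          have hfa : (f ⟨a, ha'⟩).1 ∈ zeros π₂ := hW.subset (f ⟨a, ha'⟩).2
          have := hfa φ hφ
          convert this using 1
          funext j
          exact (ht ⟨a, ha'⟩ j).symm) b h1
        rw [realize_substAtomic _ _ _ (hπ₂.2 φ hφ)] at this
        rwa [show c = fun i => tval e b (t i) from funext h2]
    · intro a c
      rw [satisfies_graphType hπ₁]
      constructor
      · rintro rfl
        refine ⟨?_, fun j => ht a j⟩
        exact hV.subset a.2
      · rintro ⟨-, h⟩
        apply Subtype.ext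
        funext j
        rw [ht a j, h j]

theorem DefinedBy.comp {U V W : AffVar L A} {f : U.carrier → V.carrier}
    {g : V.carrier → W.carrier} {t : Fin V.dim → L.Term (A ⊕ Fin U.dim)}
    {s : Fin W.dim → L.Term (A ⊕ Fin V.dim)} (hf : DefinedBy f t) (hg : DefinedBy g s) :
    DefinedBy (g ∘ f) (fun j => substTerm t (s j)) := by
  intro a j
  rw [tval_substTerm, Function.comp_apply, hg (f a) j]
  congr 1
  funext i
  exact hf a i

theorem isMorphism_id (V : AffVar L A) : IsMorphism V V id :=
  (isMorphism_iff _).2 ⟨fun i => Term.var (Sum.inr i), fun _ _ => rfl⟩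

theorem IsMorphism.comp {U V W : AffVar L A} {f : U.carrier → V.carrier}
    {g : V.carrier → W.carrier} (hf : IsMorphism U V f) (hg : IsMorphism V W g) :
    IsMorphism U W (g ∘ f) := by
  obtain ⟨t, ht⟩ := (isMorphism_iff f).1 hf
  obtain ⟨s, hs⟩ := (isMorphism_iff g).1 hg
  exact (isMorphism_iff _).2 ⟨_, ht.comp hs⟩

/-- The category `Aff_A` of affine algebraic varieties over `A`. -/
instance AffVar.category : Category (AffVar L A) where
  Hom V W := {f : V.carrier → W.carrier // IsMorphism V W f}
  id V := ⟨id, isMorphism_id V⟩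
  comp f g := ⟨g.1 ∘ f.1, f.2.comp g.2⟩

end Morphisms

/-! ### Reduced `A`-algebras -/

/-- A reduced `A`-algebra: a homomorphism from `A` into a structure in the quasivariety `Mod(T_W)`. -/
structure RedAlg {L : FirstOrder.Language.{u, v}} (T : L.Theory) (A : Type w) [L.Structure A] where
  carrier : Type (max u w)
  [str : L.Structure carrier]
  models : carrier ⊨ quasiAlgPart T
  hom : A →[L] carrier

attribute [instance] RedAlg.str

section Algebras

variable {L : FirstOrder.Language.{u, v}} {T : L.Theory} {A : Type w} [L.Structure A]

/-- The category of reduced `A`-algebras; morphisms are the homomorphisms under `A`. -/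
instance RedAlg.category : Category (RedAlg T A) where
  Hom B C := {h : B.carrier →[L] C.carrier // h.comp B.hom = C.hom}
  id B := ⟨Hom.id L B.carrier, rfl⟩
  comp f g := ⟨g.1.comp f.1, by
    rw [Hom.comp_assoc, f.2, g.2]⟩

/-- A reduced `A`-algebra is finitely presented if for some finite set `π(x₁, …, xₙ)` of atomic
formulas with parameters in `A`, it is initial among the reduced `A`-algebras equipped with a tuple
satisfying `π`. -/
def finitelyPresented (T : L.Theory) (A : Type w) [L.Structure A] : ObjectProperty (RedAlg T A) :=
  fun B => ∃ (n : ℕ) (π : Set (L.BoundedFormula A n)) (b : Fin n → B.carrier),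
    IsFiniteAType π ∧ Satisfies π B.hom b ∧
    ∀ (C : RedAlg T A) (c : Fin n → C.carrier), Satisfies π C.hom c →
      ∃! h : B ⟶ C, ∀ i, h.1 (b i) = c i

namespace CoordAlg

/-- The homomorphism `A[W] → A[V]` sending the class of `s(y)` to the class of `s(t(x))`, where `t`
is a tuple of terms defining a map `f : V → W`. -/
def comap {V W : AffVar L A} {f : V.carrier → W.carrier}
    {t : Fin W.dim → L.Term (A ⊕ Fin V.dim)} (ht : DefinedBy f t) : CoordAlg W →[L] CoordAlg V where
  toFun := Quotient.map (sa := coordSetoid W) (sb := coordSetoid V) (substTerm t) fun s s' h => by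
    refine coordSetoid_iff.2 fun a ha => ?_
    rw [tval_substTerm, tval_substTerm]
    have : (fun i => tval id a (t i)) = (f ⟨a, ha⟩).1 := funext fun j => (ht ⟨a, ha⟩ j).symm
    rw [this]
    exact coordSetoid_iff.1 h _ (f ⟨a, ha⟩).2
  map_fun' F x := by
    obtain ⟨s, rfl⟩ := exists_rep x
    rw [funMap_mk]
    exact (funMap_mk F fun i => substTerm t (s i)).symm
  map_rel' R x h := by
    obtain ⟨s, rfl⟩ := exists_rep x
    rw [relMap_mk] at h
    refine (relMap_mk R fun i => substTerm t (s i)).2 fun a ha => ?_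
    simp only [tval_substTerm]
    have : (fun i => tval id a (t i)) = (f ⟨a, ha⟩).1 := funext fun j => (ht ⟨a, ha⟩ j).symm
    rw [this]
    exact h _ (f ⟨a, ha⟩).2

theorem comap_mk {V W : AffVar L A} {f : V.carrier → W.carrier}
    {t : Fin W.dim → L.Term (A ⊕ Fin V.dim)} (ht : DefinedBy f t) (s : L.Term (A ⊕ Fin W.dim)) :
    comap ht (mk W s) = mk V (substTerm t s) := rfl

theorem comap_coord {V W : AffVar L A} {f : V.carrier → W.carrier}
    {t : Fin W.dim → L.Term (A ⊕ Fin V.dim)} (ht : DefinedBy f t) (j : Fin W.dim) :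
    comap ht (coord W j) = mk V (t j) := rfl

theorem comap_comp_ofBase {V W : AffVar L A} {f : V.carrier → W.carrier}
    {t : Fin W.dim → L.Term (A ⊕ Fin V.dim)} (ht : DefinedBy f t) :
    (comap ht).comp (ofBase W) = ofBase V := rfl

/-- `comap` depends on `f` only. -/
theorem comap_mk_eq_iff {V W : AffVar L A} {f : V.carrier → W.carrier}
    {t : Fin W.dim → L.Term (A ⊕ Fin V.dim)} (ht : DefinedBy f t) (s : L.Term (A ⊕ Fin W.dim))
    (r : L.Term (A ⊕ Fin V.dim)) :
    comap ht (mk W s) = mk V r ↔ ∀ a : V.carrier, tval id (f a).1 s = tval id a.1 r := by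
  rw [comap_mk, mk_eq]
  simp only [tval_substTerm]
  constructor
  · intro h a
    rw [← h a.1 a.2, show (f a).1 = fun j => tval id a.1 (t j) from funext fun j => ht a j]
  · intro h a ha
    rw [← h ⟨a, ha⟩,
      show (f ⟨a, ha⟩).1 = fun j => tval id a (t j) from funext fun j => ht ⟨a, ha⟩ j]

end CoordAlg

/-- The coordinate algebra of `V` as a reduced `A`-algebra. -/
def coordRedAlg (hA : A ⊨ quasiAlgPart T) (V : AffVar L A) : RedAlg T A where
  carrier := CoordAlg V
  models := CoordAlg.models hA V
  hom := CoordAlg.ofBase V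

/-- A tuple of terms defining the morphism `f`. -/
noncomputable def termsOf {V W : AffVar L A} (f : V ⟶ W) : Fin W.dim → L.Term (A ⊕ Fin V.dim) :=
  ((isMorphism_iff f.1).1 f.2).choose

theorem termsOf_spec {V W : AffVar L A} (f : V ⟶ W) : DefinedBy f.1 (termsOf f) :=
  ((isMorphism_iff f.1).1 f.2).choose_spec

/-- The affine coordinate algebra functor `V ↦ A[V]`, from `Aff_A` to the category of reduced
`A`-algebras (contravariant). If `f : V → W` is given by the terms `t`, then `A[f] : A[W] → A[V]` is
the homomorphism of `A`-algebras such that `A[f](yⱼ) = tⱼ(x)`. -/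
noncomputable def coordFunctor (hA : A ⊨ quasiAlgPart T) : (AffVar L A)ᵒᵖ ⥤ RedAlg T A where
  obj V := coordRedAlg hA V.unop
  map f := ⟨CoordAlg.comap (termsOf_spec f.unop), CoordAlg.comap_comp_ofBase _⟩
  map_id V := by
    apply Subtype.ext
    apply Hom.ext
    intro x
    obtain ⟨s, rfl⟩ := CoordAlg.mk_surj x
    exact (CoordAlg.comap_mk_eq_iff (termsOf_spec (𝟙 V.unop)) s s).2 fun _ => rfl
  map_comp {U V W} f g := by
    apply Subtype.ext
    apply Hom.ext
    intro x
    obtain ⟨s, rfl⟩ := CoordAlg.mk_surj x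
    refine (CoordAlg.comap_mk_eq_iff (termsOf_spec (g.unop ≫ f.unop)) s
      (substTerm (termsOf g.unop) (substTerm (termsOf f.unop) s))).2 fun a => ?_
    rw [tval_substTerm, tval_substTerm]
    change tval id (f.unop.1 (g.unop.1 a)).1 s = _
    congr 1
    funext i
    rw [termsOf_spec f.unop (g.unop.1 a) i]
    congr 1
    funext j
    rw [termsOf_spec g.unop a j]

end Algebras

end FormalGeometry

open FormalGeometry

/-!
The variety `V = π(A)` determines the finite type `π` up to consequences: an atomic formula `ψ` holds
at all points of `V` exactly when the quasi-algebraic sentence `∀ x, ⋀ π(x) ⇒ ψ(x)` is true in `A`.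
When `A` is geometrically closed, this sentence remains true in every reduced `A`-algebra `C`. Hence
a tuple `c` of `C` satisfying `π` satisfies every atomic formula valid on `V`, and evaluation of terms
at `c` is a well-defined homomorphism `A[V] → C` (`CoordAlg.eval`). In other words `A[V]`, with its
tuple of coordinates, is the reduced `A`-algebra presented by `π`
(`existsUnique_hom_coordRedAlg`); this is a Nullstellensatz.

Everything follows from that. Every finitely presented reduced `A`-algebra is isomorphic to a
coordinate algebra, as both are initial for the same finite type (`nonempty_iso_of_presentations`).
A morphism `A[W] → A[V]` sends the coordinates of `W` to the classes of some terms `t(x)`, and the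
equations and relations defining `W` hold of these classes, that is, of `t(a)` for all `a ∈ V`; so `t`
defines a map `V → W` inducing the given morphism. This gives fullness, and faithfulness is the fact
that the class of a term determines its values on `V`.
-/

namespace FormalGeometry

open FirstOrder.Language

section Homomorphisms

variable {L : FirstOrder.Language.{u, v}} {A : Type w} {B : Type w₁} {C : Type w₂}
  [L.Structure B] [L.Structure C]

theorem map_tval (h : B →[L] C) {n : ℕ} (f : A → B) (b : Fin n → B) (t : L.Term (A ⊕ Fin n)) :
    h (tval f b t) = tval (h ∘ f) (h ∘ b) t := by
  unfold tval
  rw [← HomClass.realize_term h, Sum.comp_elim]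

theorem realize_map_of_isAtomic (h : B →[L] C) {n : ℕ} {f : A → B} {b : Fin n → B}
    {φ : L.BoundedFormula A n} (hφ : φ.IsAtomic) (hb : φ.Realize f b) :
    φ.Realize (h ∘ f) (h ∘ b) := by
  cases hφ with
  | equal s t =>
    change tval _ _ s = tval _ _ t
    rw [← map_tval, ← map_tval]
    exact congrArg h hb
  | rel R ts =>
    change Structure.RelMap R fun i => tval _ _ (ts i)
    simp only [← map_tval]
    exact h.map_rel R _ hb

theorem Satisfies.map (h : B →[L] C) {n : ℕ} {π : Set (L.BoundedFormula A n)}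
    (hπ : IsFiniteAType π) {f : A → B} {b : Fin n → B} (hb : Satisfies π f b) :
    Satisfies π (h ∘ f) (h ∘ b) :=
  fun φ hφ => realize_map_of_isAtomic h (hπ.2 φ hφ) (hb φ hφ)

end Homomorphisms

/-! ### The universal property of coordinate algebras -/

section UniversalProperty

variable {L : FirstOrder.Language.{u, v}} {A : Type w} [L.Structure A]

namespace CoordAlg

theorem tval_coord {V : AffVar L A} (t : L.Term (A ⊕ Fin V.dim)) :
    tval (ofBase V) (coord V) t = mk V t := by
  refine (tval_mk t fun i => Term.var (Sum.inr i)).trans ?_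
  rw [mk_eq]
  intro a _
  rw [tval_substTerm]
  rfl

theorem satisfies_coord {V : AffVar L A} {π : Set (L.BoundedFormula A V.dim)}
    (hπ : IsFiniteAType π) (hV : V.carrier = zeros π) : Satisfies π (ofBase V) (coord V) :=
  fun φ hφ => (realize_atomic (hπ.2 φ hφ) fun i => Term.var (Sum.inr i)).2
    fun _ ha => hV.subset ha φ hφ

/-- Evaluation of terms at a tuple `c` satisfying the finite type `π` that defines `V`, as a
homomorphism on `A[V]`. It is well defined in models of the quasi-algebraic diagram, where `π`
implies every atomic formula valid on `V`. -/
def eval {V : AffVar L A} {π : Set (L.BoundedFormula A V.dim)} (hπ : IsFiniteAType π)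
    (hV : V.carrier = zeros π) {C : Type w₁} [L.Structure C] {e : A → C}
    (he : IsDiagramModel L e) {c : Fin V.dim → C} (hc : Satisfies π e c) : CoordAlg V →[L] C where
  toFun := Quotient.lift (s := coordSetoid V) (tval e c) fun _ _ h =>
    he.transfer hπ h.1 (fun a ha => h.2 a (hV.superset ha)) c hc
  map_fun' F x := by
    obtain ⟨s, rfl⟩ := exists_rep x
    rw [funMap_mk]
    rfl
  map_rel' R x h := by
    obtain ⟨s, rfl⟩ := exists_rep x
    rw [relMap_mk] at h
    exact he.transfer hπ (.rel R s) (fun a ha => h a (hV.superset ha)) c hc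

end CoordAlg

variable {T : L.Theory}

theorem RedAlg.hom_comp_hom {B C : RedAlg T A} (h : B ⟶ C) : h.1 ∘ B.hom = C.hom :=
  funext fun a => DFunLike.congr_fun h.2 a

theorem RedAlg.satisfies_map {B C : RedAlg T A} (h : B ⟶ C) {n : ℕ}
    {π : Set (L.BoundedFormula A n)} (hπ : IsFiniteAType π) {b : Fin n → B.carrier}
    (hb : Satisfies π B.hom b) : Satisfies π C.hom (h.1 ∘ b) := by
  rw [← RedAlg.hom_comp_hom h]
  exact hb.map h.1 hπ

/-- A morphism out of `A[V]` is evaluation at the images of the coordinates. -/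
theorem coordRedAlg_hom_mk {hA : A ⊨ quasiAlgPart T} {V : AffVar L A} {C : RedAlg T A}
    (h : coordRedAlg hA V ⟶ C) (t : L.Term (A ⊕ Fin V.dim)) :
    h.1 (CoordAlg.mk V t) = tval C.hom (h.1 ∘ CoordAlg.coord V) t := by
  rw [← RedAlg.hom_comp_hom h, ← CoordAlg.tval_coord]
  exact map_tval h.1 _ _ t

theorem coordRedAlg_hom_ext {hA : A ⊨ quasiAlgPart T} {V : AffVar L A} {C : RedAlg T A}
    {g h : coordRedAlg hA V ⟶ C}
    (hgh : ∀ i, g.1 (CoordAlg.coord V i) = h.1 (CoordAlg.coord V i)) : g = h := by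
  apply Subtype.ext
  apply Hom.ext
  intro x
  obtain ⟨t, rfl⟩ := CoordAlg.mk_surj x
  rw [coordRedAlg_hom_mk, coordRedAlg_hom_mk, show g.1 ∘ _ = h.1 ∘ _ from funext hgh]

theorem GeometricallyClosed.isDiagramModel (hA : GeometricallyClosed T A) (C : RedAlg T A) :
    IsDiagramModel L C.hom :=
  fun σ hσ => hA.2 C.carrier C.models C.hom σ hσ.1 hσ.2

/-- If `A` is geometrically closed and `V = π(A)`, then `A[V]` with its tuple of coordinates is
initial among the reduced `A`-algebras with a tuple satisfying `π`. -/
theorem existsUnique_hom_coordRedAlg (hA : GeometricallyClosed T A) {V : AffVar L A}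
    {π : Set (L.BoundedFormula A V.dim)} (hπ : IsFiniteAType π) (hV : V.carrier = zeros π)
    (C : RedAlg T A) (c : Fin V.dim → C.carrier) (hc : Satisfies π C.hom c) :
    ∃! h : coordRedAlg hA.1 V ⟶ C, ∀ i, h.1 (CoordAlg.coord V i) = c i :=
  ⟨⟨CoordAlg.eval hπ hV (hA.isDiagramModel C) hc, rfl⟩, fun _ => rfl,
    fun _ hh => coordRedAlg_hom_ext hh⟩

/-- Two reduced `A`-algebras presented by the same finite type are isomorphic. -/
theorem nonempty_iso_of_presentations {n : ℕ} {π : Set (L.BoundedFormula A n)} {B B' : RedAlg T A}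
    {b : Fin n → B.carrier} {b' : Fin n → B'.carrier}
    (hb : Satisfies π B.hom b) (hb' : Satisfies π B'.hom b')
    (hB : ∀ (C : RedAlg T A) (c : Fin n → C.carrier), Satisfies π C.hom c →
      ∃! h : B ⟶ C, ∀ i, h.1 (b i) = c i)
    (hB' : ∀ (C : RedAlg T A) (c : Fin n → C.carrier), Satisfies π C.hom c →
      ∃! h : B' ⟶ C, ∀ i, h.1 (b' i) = c i) : Nonempty (B ≅ B') := by
  obtain ⟨g, hg, -⟩ := hB B' b' hb'
  obtain ⟨g', hg', -⟩ := hB' B b hb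
  refine ⟨⟨g, g', (hB B b hb).unique (fun i => ?_) fun _ => rfl,
    (hB' B' b' hb').unique (fun i => ?_) fun _ => rfl⟩⟩
  · exact (congrArg g'.1 (hg i)).trans (hg' i)
  · exact (congrArg g.1 (hg' i)).trans (hg i)

end UniversalProperty

/-! ### The coordinate algebra functor -/

section Functor

variable {L : FirstOrder.Language.{u, v}} {T : L.Theory} {A : Type w} [L.Structure A]

theorem coordFunctor_map_coord (hA : A ⊨ quasiAlgPart T) {V W : AffVar L A} (f : V ⟶ W)
    (j : Fin W.dim) :
    ((coordFunctor hA).map f.op).1 (CoordAlg.coord W j) = CoordAlg.mk V (termsOf f j) := rfl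

instance faithful_coordFunctor (hA : A ⊨ quasiAlgPart T) : (coordFunctor hA).Faithful where
  map_injective {W V} f g h := by
    apply Quiver.Hom.unop_inj
    apply Subtype.ext
    funext a
    apply Subtype.ext
    funext j
    have hj : CoordAlg.mk V.unop (termsOf f.unop j) = CoordAlg.mk V.unop (termsOf g.unop j) :=
      congrArg (fun k : coordRedAlg hA W.unop ⟶ coordRedAlg hA V.unop =>
        k.1 (CoordAlg.coord W.unop j)) h
    rw [termsOf_spec f.unop a j, termsOf_spec g.unop a j]
    exact CoordAlg.mk_eq.1 hj a.1 a.2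

/-- Terms whose classes satisfy in `A[V]` a finite type defining `W` map the points of `V` into
`W`. -/
theorem tval_mem_of_satisfies {V W : AffVar L A} {π : Set (L.BoundedFormula A W.dim)}
    (hπ : IsFiniteAType π) (hW : W.carrier = zeros π) {t : Fin W.dim → L.Term (A ⊕ Fin V.dim)}
    (ht : Satisfies π (CoordAlg.ofBase V) fun j => CoordAlg.mk V (t j)) (a : V.carrier) :
    (fun j => tval id a.1 (t j)) ∈ W.carrier :=
  hW.superset fun φ hφ => (CoordAlg.realize_atomic (hπ.2 φ hφ) t).1 (ht φ hφ) a.1 a.2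

instance full_coordFunctor (hA : A ⊨ quasiAlgPart T) : (coordFunctor hA).Full where
  map_surjective {W V} h := by
    obtain ⟨π, hπ, hW⟩ := W.unop.isAffine
    obtain ⟨t, ht⟩ := CoordAlg.exists_rep (V := V.unop) (h.1 ∘ CoordAlg.coord W.unop)
    have hsat : Satisfies π (CoordAlg.ofBase V.unop) fun j => CoordAlg.mk V.unop (t j) := by
      rw [← ht]
      exact RedAlg.satisfies_map h hπ (CoordAlg.satisfies_coord hπ hW)
    let f : V.unop ⟶ W.unop :=
      ⟨fun a => ⟨_, tval_mem_of_satisfies hπ hW hsat a⟩, (isMorphism_iff _).2 ⟨t, fun _ _ => rfl⟩⟩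
    refine ⟨f.op, coordRedAlg_hom_ext (hA := hA) (V := W.unop) fun j => ?_⟩
    refine (coordFunctor_map_coord hA f j).trans (Eq.trans ?_ (congrFun ht j).symm)
    exact CoordAlg.mk_eq.2 fun a ha => (termsOf_spec f ⟨a, ha⟩ j).symm

theorem finitelyPresented_coordFunctor_obj (hA : GeometricallyClosed T A) (V : (AffVar L A)ᵒᵖ) :
    finitelyPresented T A ((coordFunctor hA.1).obj V) :=
  let ⟨π, hπ, hV⟩ := V.unop.isAffine
  ⟨V.unop.dim, π, CoordAlg.coord V.unop, hπ, CoordAlg.satisfies_coord hπ hV,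
    existsUnique_hom_coordRedAlg hA hπ hV⟩

theorem exists_coordRedAlg_iso (hA : GeometricallyClosed T A) {B : RedAlg T A}
    (hB : finitelyPresented T A B) : ∃ V : AffVar L A, Nonempty (coordRedAlg hA.1 V ≅ B) := by
  obtain ⟨n, π, b, hπ, hb, hB⟩ := hB
  let V : AffVar L A := ⟨n, zeros π, π, hπ, rfl⟩
  exact ⟨V, nonempty_iso_of_presentations (CoordAlg.satisfies_coord (V := V) hπ rfl) hb
    (existsUnique_hom_coordRedAlg (V := V) hA hπ rfl) hB⟩

end Functor

end FormalGeometry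

open FormalGeometry
theorem mainTheorem7 {L : FirstOrder.Language.{u, v}} (T : L.Theory) (A : Type w) [L.Structure A]
    (hA : GeometricallyClosed T A) :
    ∃ h : ∀ V : (AffVar L A)ᵒᵖ, finitelyPresented T A ((coordFunctor hA.1).obj V),
      ((finitelyPresented T A).lift (coordFunctor hA.1) h).IsEquivalence := by
  refine ⟨finitelyPresented_coordFunctor_obj hA,
    { faithful := inferInstance, full := inferInstance, essSurj := ⟨fun B => ?_⟩ }⟩
  obtain ⟨V, ⟨e⟩⟩ := exists_coordRedAlg_iso hA B.property
  exact ⟨.op V, ⟨(finitelyPresented T A).isoMk e⟩⟩
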